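/- Let $K\subseteq\mathbb R^n$ be a proper cone, i.e. a nonempty closed convex cone (closed under nonnegative linear combinations) with $K\cap(-K)=\{0\}$ and nonempty interior, and let $A$ be a real $n\times n$ matrix with $AK\subseteq K$ (written $A\in\pi(K)$). Let $\rho(A)$ be the spectral radius of $A$ (the maximum modulus of its complex eigenvalues), and $\mathcal N(\cdot)$ the null space in $\mathbb R^n$. For $x\in\mathbb R^n$ let $\rho_x(A)=\limsup_{m\to\infty}\|A^mx\|^{1/m}$ if $x\ne0$, and $\rho_0(A)=0$, be the local spectral radius of $A$ at $x$. Let $$\Sigma_1=\Sigma_1(A)=\{\sigma\ge 0:\ \sigma x-Ax\in K\ \text{for some}\ x\in\operatorname{int}K\}.$$ A face of $K$ is a nonempty convex cone $F\subseteq K$ such that $x\in F$, $y\in K$ and $x-y\in K$ imply $y\in F$. For $S\subseteq K$ let $\Phi(S)$ be the intersection of all faces of $K$ that include $S$. (1) We have $\inf\Sigma_1=\rho(A)$. If moreover $\rho(A)>0$ and $C=\{x\in K:\rho_x(A)<\rho(A)\}$, then $$\rho(A)\in\Sigma_1\iff \Phi\bigl((\mathcal N(\rho(A)I_n-A)\cap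 K)\cup C\bigr)=K .$$ (2) Let $P$ be an entrywise nonnegative $n\times n$ matrix and $K=\mathbb R^n_+$. Say that $i$ has access to $j$ if there is a path (possibly of length $0$) from $i$ to $j$ in the directed graph with an arc $i\to j$ whenever $P_{ij}\neq0$. The classes of $P$ are the equivalence classes of indices having access to each other. A class $\alpha$ is basic if the principal submatrix $P_{\alpha\alpha}$ satisfies $\rho(P_{\alpha\alpha})=\rho(P)$, and final if no index of $\alpha$ has access to an index of another class. Then $\rho(P)\in\Sigma_1(P)$ if and only if every basic class of $P$ is final. -/

import Mathlib

open scoped Matrix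

noncomputable section

namespace ConeMap

/-- A proper cone in `ℝⁿ` in the sense of Perron-Frobenius theory. Mathlib's `ProperCone` is a closed
convex cone containing `0`; we ask in addition that it be pointed (`K ∩ -K = {0}`) and full
(nonempty interior). -/
structure IsPointedFull {n : ℕ} (K : ProperCone ℝ (Fin n → ℝ)) : Prop where
  pointed : ∀ x : Fin n → ℝ, x ∈ K → -x ∈ K → x = 0
  full : (interior (K : Set (Fin n → ℝ))).Nonempty

/-- `A ∈ π(K)`: the matrix `A` maps `K` into itself. -/
def Preserves {n : ℕ} (K : ProperCone ℝ (Fin n → ℝ)) (A : Matrix (Fin n) (Fin n) ℝ) : Prop :=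
  ∀ x ∈ K, A *ᵥ x ∈ K

/-- `Φ(S)`: the face of `K` generated by `S`, i.e. the intersection of all faces of `K`
including `S`. -/
def generatedFace {n : ℕ} (K : ProperCone ℝ (Fin n → ℝ)) (S : Set (Fin n → ℝ)) :
    Set (Fin n → ℝ) :=
  {x | ∀ F : PointedCone ℝ (Fin n → ℝ), F.IsFaceOf K.toPointedCone →
    S ⊆ (F : Set (Fin n → ℝ)) → x ∈ F}

/-- `ρ(A)`: the spectral radius of a real square matrix, the largest modulus of its complex
eigenvalues (and `0` for the empty matrix). -/
def rho {m : Type*} [Fintype m] [DecidableEq m] (A : Matrix m m ℝ) : ℝ :=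
  (spectralRadius ℂ (A.map Complex.ofReal)).toReal

/-- `ρ_x(A)`: the local spectral radius of `A` at `x`, which is `0` if `x = 0` and
`limsup ‖A ^ m x‖ ^ (1 / m)` otherwise. The sequence is nonnegative and bounded, and the value does
not depend on the norm; the norm used here is the maximum norm. -/
def localRho {n : ℕ} (A : Matrix (Fin n) (Fin n) ℝ) (x : Fin n → ℝ) : ℝ :=
  if x = 0 then 0
  else Filter.limsup (fun m : ℕ => ‖(A ^ m) *ᵥ x‖ ^ (1 / (m : ℝ))) Filter.atTop

/-- The Collatz-Wielandt set `Σ₁(A) = {σ ≥ 0 : ∃ x ∈ int K, σ x - A x ∈ K}`. -/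
def sigmaOne {n : ℕ} (K : ProperCone ℝ (Fin n → ℝ)) (A : Matrix (Fin n) (Fin n) ℝ) : Set ℝ :=
  {σ | 0 ≤ σ ∧ ∃ x ∈ interior (K : Set (Fin n → ℝ)), σ • x - A *ᵥ x ∈ K}

/-- `N(ρ(A) I - A)`: the null space of `ρ(A) I - A` in `ℝⁿ`. -/
def perronNullspace {n : ℕ} (A : Matrix (Fin n) (Fin n) ℝ) : Set (Fin n → ℝ) :=
  {x | (rho A • (1 : Matrix (Fin n) (Fin n) ℝ) - A) *ᵥ x = 0}

/-- `C = {x ∈ K : ρ_x(A) < ρ(A)}`. -/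
def lowerPart {n : ℕ} (K : ProperCone ℝ (Fin n → ℝ)) (A : Matrix (Fin n) (Fin n) ℝ) :
    Set (Fin n → ℝ) :=
  {x | x ∈ K ∧ localRho A x < rho A}

/-- `i` has access to `j` in the directed graph of `P` (with an arc from `i` to `j` when
`P i j ≠ 0`): there is a directed path, possibly of length `0`, from `i` to `j`. -/
def HasAccess {n : ℕ} (P : Matrix (Fin n) (Fin n) ℝ) : Fin n → Fin n → Prop :=
  Relation.ReflTransGen (fun i j => P i j ≠ 0)

/-- The classes of `P`: the equivalence classes of indices that have access to each other. -/
def IsClass {n : ℕ} (P : Matrix (Fin n) (Fin n) ℝ) (α : Finset (Fin n)) : Prop :=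
  ∃ i, ∀ j, j ∈ α ↔ HasAccess P i j ∧ HasAccess P j i

/-- A class `α` is basic if `ρ(P_αα) = ρ(P)`. -/
def IsBasic {n : ℕ} (P : Matrix (Fin n) (Fin n) ℝ) (α : Finset (Fin n)) : Prop :=
  rho (P.submatrix (fun i : α => (i : Fin n)) (fun i : α => (i : Fin n))) = rho P

/-- A class `α` is final if it has access to no other class. -/
def IsFinal {n : ℕ} (P : Matrix (Fin n) (Fin n) ℝ) (α : Finset (Fin n)) : Prop :=
  ∀ β : Finset (Fin n), IsClass P β → (∃ i ∈ α, ∃ j ∈ β, HasAccess P i j) → β = α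

end ConeMap

end

/-! Order K by `x ≤ y` iff `y - x ∈ K`, and rescale to `B = σ⁻¹ • A`, so that `σ • x - A *ᵥ x ∈ K`
reads `B x ≤ x`. If such an `x` is interior, it is an order unit and `B ^ m x ≤ x`; normality of K
bounds every orbit of `B`, whence `rho A ≤ σ`. Conversely, for `σ > rho A` the Neumann series `∑ B ^
m y` at an interior `y` is an admissible `x`. This gives the infimum.

At `σ = rho A > 0`, an admissible `x` has a decreasing orbit, which converges to a fixed vector `u`
of `B`, and `x - u ≥ 0` has orbit tending to `0`. In finite dimension this decay is automatically
geometric, so it is the same as `localRho A (x - u) < rho A`. Hence `x` is a null vector plus an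
element of `C`. Conversely, if such a sum `u + w` is interior, replacing `w` by its Neumann series
makes it admissible. Interior points of a convex cone are exactly what generates K as a face.

For nonnegative matrices, a positive subinvariant vector at level `rho P` restricts to an exact
Perron vector on each basic class, leaving no room for outgoing arcs. Conversely, Perron-type
vectors of the classes are glued with weights growing rapidly along the access order. -/

noncomputable section

namespace ConeMap

open Filter Topology

/-! ### Spectral radius and growth of orbits. -/

section SpectralRadius

attribute [local instance] Matrix.linftyOpNormedRing Matrix.linftyOpNormedAlgebra

variable {ι : Type*} [Fintype ι] [DecidableEq ι]

theorem map_ofReal_pow (A : Matrix ι ι ℝ) (m : ℕ) :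
    (A.map Complex.ofReal) ^ m = (A ^ m).map Complex.ofReal :=
  (map_pow (Complex.ofRealHom.mapMatrix (m := ι)) A m).symm

theorem norm_map_ofReal (A : Matrix ι ι ℝ) : ‖A.map Complex.ofReal‖ = ‖A‖ := by
  simp [Matrix.linfty_opNorm_def]

theorem spectralRadius_ne_top (A : Matrix ι ι ℝ) :
    spectralRadius ℂ (A.map Complex.ofReal) ≠ ⊤ := by
  have h := spectrum.spectralRadius_le_pow_nnnorm_pow_one_div ℂ (A.map Complex.ofReal) 0
  refine ne_top_of_le_ne_top ?_ h
  norm_num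
  exact ENNReal.mul_ne_top (by simp) (by simp)

theorem smul_inv_pow_mulVec (A : Matrix ι ι ℝ) (σ : ℝ) (m : ℕ) (w : ι → ℝ) :
    ((σ⁻¹ • A) ^ m) *ᵥ w = (σ ^ m)⁻¹ • ((A ^ m) *ᵥ w) := by
  rw [smul_pow, Matrix.smul_mulVec, inv_pow]

/-- Gelfand's formula for the complexification gives `‖A ^ m‖ ≤ τ ^ m` eventually, for any `τ`
strictly between `rho A` and `σ`. -/
theorem tendsto_pow_mulVec_of_rho_lt {A : Matrix ι ι ℝ} {σ : ℝ} (h : rho A < σ) (w : ι → ℝ) :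
    Tendsto (fun m : ℕ => ((σ⁻¹ • A) ^ m) *ᵥ w) atTop (𝓝 0) := by
  obtain ⟨τ, h1, h2⟩ := exists_between h
  have h0 : 0 ≤ rho A := ENNReal.toReal_nonneg
  have hτ : 0 < τ := h0.trans_lt h1
  have hσ : 0 < σ := hτ.trans h2
  have hlt : spectralRadius ℂ (A.map Complex.ofReal) < ENNReal.ofReal τ :=
    (ENNReal.lt_ofReal_iff_toReal_lt (spectralRadius_ne_top A)).2 h1
  have hg := spectrum.pow_norm_pow_one_div_tendsto_nhds_spectralRadius (A.map Complex.ofReal)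
  have hev : ∀ᶠ m : ℕ in atTop, ‖A ^ m‖ ≤ τ ^ m := by
    filter_upwards [hg.eventually (gt_mem_nhds hlt), eventually_gt_atTop 0] with m hm hm0
    rw [map_ofReal_pow, norm_map_ofReal, ENNReal.ofReal_lt_ofReal_iff hτ] at hm
    have hm' : (0 : ℝ) < m := by exact_mod_cast hm0
    have := Real.rpow_le_rpow (by positivity) hm.le hm'.le
    rwa [← Real.rpow_mul (norm_nonneg _), one_div_mul_cancel hm'.ne', Real.rpow_one,
      Real.rpow_natCast] at this
  have hlim : Tendsto (fun m : ℕ => (τ / σ) ^ m * ‖w‖) atTop (𝓝 0) := by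
    simpa using (tendsto_pow_atTop_nhds_zero_of_lt_one (by positivity)
      ((div_lt_one hσ).2 h2)).mul_const ‖w‖
  refine squeeze_zero_norm' ?_ hlim
  filter_upwards [hev] with m hm
  rw [smul_inv_pow_mulVec, norm_smul, norm_inv, norm_pow, Real.norm_of_nonneg hσ.le, div_pow,
    div_eq_inv_mul, mul_assoc]
  gcongr
  exact (Matrix.linfty_opNorm_mulVec _ _).trans (by gcongr)

/-- Bounds on the basis vectors give `‖A ^ m‖ ≤ const * σ ^ m`, while an eigenvalue `k` forces `‖k‖
^ m ≤ const * ‖A ^ m‖`; so `‖k‖ > σ` is impossible. -/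
theorem rho_le_of_bounded {A : Matrix ι ι ℝ} {σ : ℝ} (hσ : 0 < σ)
    (h : ∀ w : ι → ℝ, ∃ C : ℝ, ∀ m : ℕ, ‖((σ⁻¹ • A) ^ m) *ᵥ w‖ ≤ C) : rho A ≤ σ := by
  choose C hC using h
  have hb : ∀ m : ℕ, ‖A ^ m‖ ≤ (∑ j, C (Pi.single j 1)) * σ ^ m := by
    intro m
    rw [Matrix.linfty_opNorm_def]
    have key : ∀ i j, ‖(A ^ m) i j‖ ≤ C (Pi.single j 1) * σ ^ m := by
      intro i j
      have h1 := (norm_le_pi_norm _ i).trans (hC (Pi.single j 1) m)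
      rw [smul_inv_pow_mulVec] at h1
      simp only [Matrix.mulVec_single_one, Pi.smul_apply, norm_smul, norm_inv, norm_pow,
        Real.norm_of_nonneg hσ.le, Matrix.col_apply] at h1
      rwa [inv_mul_le_iff₀ (by positivity), mul_comm] at h1
    have hn : ∀ j, 0 ≤ C (Pi.single j 1) := fun j => (norm_nonneg _).trans (hC _ 0)
    have hpos : 0 ≤ (∑ j, C (Pi.single j 1)) * σ ^ m :=
      mul_nonneg (Finset.sum_nonneg fun j _ => hn j) (by positivity)
    lift (∑ j, C (Pi.single j 1)) * σ ^ m to NNReal using hpos with t ht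
    rw [NNReal.coe_le_coe]
    refine Finset.sup_le fun i _ => ?_
    rw [← NNReal.coe_le_coe, ht, NNReal.coe_sum, Finset.sum_mul]
    exact Finset.sum_le_sum fun j _ => key i j
  refine ENNReal.toReal_le_of_le_ofReal hσ.le (iSup₂_le fun k hk => ?_)
  rw [← enorm_eq_nnnorm, ← ofReal_norm]
  refine ENNReal.ofReal_le_ofReal ?_
  by_contra! hlt
  have hbd : ∀ m : ℕ, (‖k‖ / σ) ^ m ≤ (∑ j, C (Pi.single j 1)) * ‖(1 : Matrix ι ι ℂ)‖ := by
    intro m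
    have h1 := spectrum.norm_le_norm_mul_of_mem (spectrum.pow_mem_pow _ m hk)
    rw [map_ofReal_pow, norm_map_ofReal, norm_pow] at h1
    rw [div_pow, div_le_iff₀ (by positivity)]
    calc ‖k‖ ^ m ≤ ‖A ^ m‖ * ‖(1 : Matrix ι ι ℂ)‖ := h1
      _ ≤ ((∑ j, C (Pi.single j 1)) * σ ^ m) * ‖(1 : Matrix ι ι ℂ)‖ := by gcongr; exact hb m
      _ = _ := by ring
  obtain ⟨m, hm⟩ := pow_unbounded_of_one_lt
    ((∑ j, C (Pi.single j 1)) * ‖(1 : Matrix ι ι ℂ)‖) ((one_lt_div hσ).2 hlt)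
  exact absurd (hbd m) (not_le.2 hm)

end SpectralRadius

theorem rho_nonneg {ι : Type*} [Fintype ι] [DecidableEq ι] (A : Matrix ι ι ℝ) : 0 ≤ rho A :=
  ENNReal.toReal_nonneg

/-! ### Stable vectors, geometric decay and the local spectral radius. -/

section Geometric

variable {ι : Type*} [Fintype ι] [DecidableEq ι]

/-- The subspace of vectors whose orbit under `B` tends to `0`. -/
def stableSubspace (B : Matrix ι ι ℝ) : Submodule ℝ (ι → ℝ) where
  carrier := {w | Tendsto (fun m : ℕ => (B ^ m) *ᵥ w) atTop (𝓝 0)}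
  add_mem' {a b} ha hb := by
    simpa [Matrix.mulVec_add] using Tendsto.add ha hb
  zero_mem' := by simp
  smul_mem' c x hx := by
    simpa [Matrix.mulVec_smul] using Tendsto.const_smul hx c

theorem mem_stableSubspace {B : Matrix ι ι ℝ} {w : ι → ℝ} :
    w ∈ stableSubspace B ↔ Tendsto (fun m : ℕ => (B ^ m) *ᵥ w) atTop (𝓝 0) := Iff.rfl

theorem pow_mulVec_mem_stableSubspace {B : Matrix ι ι ℝ} {w : ι → ℝ} (hw : w ∈ stableSubspace B)
    (k : ℕ) : (B ^ k) *ᵥ w ∈ stableSubspace B := by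
  rw [mem_stableSubspace] at hw ⊢
  simpa [Matrix.mulVec_mulVec, ← pow_add] using (tendsto_add_atTop_iff_nat k).2 hw

/-- Finite dimension makes pointwise convergence uniform: the operator norm on the stable subspace
is controlled by finitely many basis vectors. -/
theorem exists_contracting_pow (B : Matrix ι ι ℝ) :
    ∃ M : ℕ, 0 < M ∧ ∀ w ∈ stableSubspace B, ‖(B ^ M) *ᵥ w‖ ≤ (1 / 2) * ‖w‖ := by
  let v := Module.finBasis ℝ (stableSubspace B)
  obtain ⟨C, hC, h⟩ := v.exists_opNorm_le (F := ι → ℝ)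
  have hev : ∀ᶠ m : ℕ in atTop, ∀ i, ‖(B ^ m) *ᵥ (v i : ι → ℝ)‖ ≤ 1 / (2 * C) := by
    rw [eventually_all]
    intro i
    have h1 := (tendsto_zero_iff_norm_tendsto_zero.1 (mem_stableSubspace.1 (v i).2))
    exact (h1.eventually (gt_mem_nhds (show (0 : ℝ) < 1 / (2 * C) by positivity))).mono
      fun _ hm => hm.le
  obtain ⟨M, hM, hM0⟩ := (hev.and (eventually_gt_atTop 0)).exists
  refine ⟨M, hM0, fun w hw => ?_⟩
  let u : stableSubspace B →L[ℝ] (ι → ℝ) :=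
    LinearMap.toContinuousLinearMap ((Matrix.mulVecLin (B ^ M)).comp (stableSubspace B).subtype)
  have hu := h (u := u) (M := 1 / (2 * C)) (by positivity) fun i => hM i
  have h2 := u.le_opNorm ⟨w, hw⟩
  have h3 : C * (1 / (2 * C)) = 1 / 2 := by field_simp
  rw [h3] at hu
  calc ‖(B ^ M) *ᵥ w‖ = ‖u ⟨w, hw⟩‖ := rfl
    _ ≤ ‖u‖ * ‖w‖ := h2
    _ ≤ _ := by gcongr

theorem exists_geometric_bound {B : Matrix ι ι ℝ} {w : ι → ℝ} (hw : w ∈ stableSubspace B) :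
    ∃ τ C : ℝ, 0 < τ ∧ τ < 1 ∧ 0 ≤ C ∧ ∀ m : ℕ, ‖(B ^ m) *ᵥ w‖ ≤ C * τ ^ m := by
  obtain ⟨M, hM0, hM⟩ := exists_contracting_pow B
  have hM1 : (1 : ℝ) ≤ M := by exact_mod_cast hM0
  -- Bernoulli's inequality gives `τ ^ M ≥ 1 / 2`, so one block of `M` steps decays at least as fast
  -- as `τ ^ M`; the constant below covers the orders `m < M`.
  set τ : ℝ := 1 - 1 / (2 * M) with hτ
  have hd : 1 / (2 * (M : ℝ)) ≤ 1 / 2 := by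
    apply one_div_le_one_div_of_le <;> linarith
  have hd0 : 0 < 1 / (2 * (M : ℝ)) := by positivity
  have hτ0 : 0 < τ := by linarith
  have hpow : 1 / 2 ≤ τ ^ M := by
    have := one_add_mul_le_pow (a := -(1 / (2 * (M : ℝ)))) (by linarith) M
    have h3 : 1 + (M : ℝ) * -(1 / (2 * (M : ℝ))) = 1 / 2 := by field_simp; norm_num
    rw [h3, ← sub_eq_add_neg] at this
    exact this
  have hC0 : 0 ≤ ∑ r ∈ Finset.range M, ‖(B ^ r) *ᵥ w‖ / τ ^ r :=
    Finset.sum_nonneg fun r _ => by positivity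
  refine ⟨τ, ∑ r ∈ Finset.range M, ‖(B ^ r) *ᵥ w‖ / τ ^ r, hτ0, by linarith, hC0, fun m => ?_⟩
  induction m using Nat.strong_induction_on with
  | _ m ih =>
    rcases lt_or_ge m M with hm | hm
    · rw [← div_le_iff₀ (by positivity)]
      exact Finset.single_le_sum (f := fun r => ‖(B ^ r) *ᵥ w‖ / τ ^ r)
        (fun r _ => by positivity) (Finset.mem_range.2 hm)
    · obtain ⟨k, rfl⟩ := Nat.exists_eq_add_of_le hm
      rw [pow_add, ← Matrix.mulVec_mulVec]
      refine (hM _ (pow_mulVec_mem_stableSubspace hw k)).trans ?_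
      calc _ ≤ τ ^ M * (_ * τ ^ k) :=
            mul_le_mul hpow (ih k (by omega)) (norm_nonneg _) (by positivity)
        _ = _ := by ring

theorem summable_pow_mulVec {B : Matrix ι ι ℝ} {w : ι → ℝ} (hw : w ∈ stableSubspace B) :
    Summable fun m : ℕ => (B ^ m) *ᵥ w := by
  obtain ⟨τ, C, h0, h1, -, h⟩ := exists_geometric_bound hw
  exact Summable.of_norm_bounded ((summable_geometric_of_lt_one h0.le h1).mul_left C) h

/-- The Neumann series solves `z - B z = w`. -/
theorem tsum_sub_mulVec_tsum {B : Matrix ι ι ℝ} {w : ι → ℝ} (hw : w ∈ stableSubspace B) :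
    (∑' m : ℕ, (B ^ m) *ᵥ w) - B *ᵥ (∑' m : ℕ, (B ^ m) *ᵥ w) = w := by
  have hs := summable_pow_mulVec hw
  have h1 : B *ᵥ (∑' m : ℕ, (B ^ m) *ᵥ w) = ∑' m : ℕ, (B ^ (m + 1)) *ᵥ w := by
    have := (LinearMap.toContinuousLinearMap (Matrix.mulVecLin B)).map_tsum hs
    simpa [Matrix.mulVec_mulVec, ← pow_succ'] using this
  rw [h1, hs.tsum_eq_zero_add]
  simp

/-- Geometric decay of the rescaled orbit is what turns mere convergence to `0` into a strict
inequality of growth rates. -/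
theorem localRho_lt_rho_iff {n : ℕ} {A : Matrix (Fin n) (Fin n) ℝ} (hρ : 0 < rho A)
    (w : Fin n → ℝ) : localRho A w < rho A ↔ w ∈ stableSubspace ((rho A)⁻¹ • A) := by
  have hnorm : ∀ m : ℕ, ‖(A ^ m) *ᵥ w‖ = rho A ^ m * ‖(((rho A)⁻¹ • A) ^ m) *ᵥ w‖ := by
    intro m
    rw [smul_inv_pow_mulVec, norm_smul, norm_inv, norm_pow, Real.norm_of_nonneg hρ.le,
      mul_inv_cancel_left₀ (by positivity)]
  unfold localRho
  split_ifs with hw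
  · simp [hw, hρ, zero_mem]
  have hcob : IsCoboundedUnder (· ≤ ·) atTop (fun m : ℕ => ‖(A ^ m) *ᵥ w‖ ^ (1 / (m : ℝ))) :=
    IsBoundedUnder.isCoboundedUnder_le ⟨0, eventually_map.2 <| Eventually.of_forall
      fun m => by positivity⟩
  constructor
  · intro h
    -- A real `limsup` carries no information for a sequence unbounded above, so boundedness must
    -- come first.
    have hbdd : IsBoundedUnder (· ≤ ·) atTop (fun m : ℕ => ‖(A ^ m) *ᵥ w‖ ^ (1 / (m : ℝ))) := by
      have hσ : rho A < rho A + 1 := by linarith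
      have ht := tendsto_zero_iff_norm_tendsto_zero.1 (tendsto_pow_mulVec_of_rho_lt hσ w)
      refine ⟨rho A + 1, eventually_map.2 ?_⟩
      filter_upwards [ht.eventually (gt_mem_nhds zero_lt_one), eventually_gt_atTop 0] with m hm hm0
      rw [smul_inv_pow_mulVec, norm_smul, norm_inv, norm_pow,
        Real.norm_of_nonneg (by linarith), inv_mul_lt_iff₀ (by positivity), mul_one] at hm
      have hm' : (0 : ℝ) < m := by exact_mod_cast hm0
      have := Real.rpow_le_rpow (norm_nonneg _) hm.le (one_div_pos.2 hm').le
      rwa [← Real.rpow_natCast (rho A + 1), ← Real.rpow_mul (by linarith),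
        mul_one_div_cancel hm'.ne', Real.rpow_one] at this
    obtain ⟨τ, h1, h2⟩ := exists_between h
    have hev := eventually_lt_of_limsup_lt h1 hbdd
    obtain ⟨m₀, hm₀⟩ := hev.exists
    have hτ : 0 < τ := lt_of_le_of_lt (by positivity) hm₀
    rw [mem_stableSubspace]
    refine squeeze_zero_norm' (a := fun m : ℕ => (τ / rho A) ^ m) ?_
      (tendsto_pow_atTop_nhds_zero_of_lt_one (by positivity) ((div_lt_one hρ).2 h2))
    filter_upwards [hev, eventually_gt_atTop 0] with m hm hm0
    have hm' : (0 : ℝ) < m := by exact_mod_cast hm0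
    have := Real.rpow_le_rpow (by positivity) hm.le hm'.le
    rw [← Real.rpow_mul (norm_nonneg _), one_div_mul_cancel hm'.ne', Real.rpow_one,
      Real.rpow_natCast, hnorm] at this
    rw [div_pow, le_div_iff₀ (by positivity), mul_comm]
    exact this
  · intro h
    obtain ⟨τ, C, h0, h1, hC, hb⟩ := exists_geometric_bound h
    -- The slightly larger rate `τ'` absorbs the constant `C`.
    obtain ⟨τ', h2, h3⟩ := exists_between h1
    have hτ' : 0 < τ' := h0.trans h2
    refine lt_of_le_of_lt (limsup_le_of_le hcob (a := rho A * τ') ?_)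
      (mul_lt_of_lt_one_right hρ h3)
    have ht : Tendsto (fun m : ℕ => C * (τ / τ') ^ m) atTop (𝓝 0) := by
      simpa using (tendsto_pow_atTop_nhds_zero_of_lt_one (by positivity)
        ((div_lt_one hτ').2 h2)).const_mul C
    filter_upwards [ht.eventually (gt_mem_nhds zero_lt_one), eventually_gt_atTop 0] with m hm hm0
    have hm' : (0 : ℝ) < m := by exact_mod_cast hm0
    rw [div_pow, ← mul_div_assoc, div_lt_one (by positivity)] at hm
    have hle : ‖(A ^ m) *ᵥ w‖ ≤ (rho A * τ') ^ m := by
      rw [hnorm, mul_pow]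
      gcongr
      exact (hb m).trans hm.le
    have := Real.rpow_le_rpow (norm_nonneg _) hle (one_div_pos.2 hm').le
    rwa [← Real.rpow_natCast (rho A * τ'), ← Real.rpow_mul (by positivity),
      mul_one_div_cancel hm'.ne', Real.rpow_one] at this

end Geometric

/-! ### Order structure of proper cones and subinvariant interior vectors. -/

section Cone

variable {ι : Type*} {K : ProperCone ℝ (ι → ℝ)}

theorem exists_pos_smul_sub_mem {x : ι → ℝ} (hx : x ∈ interior (K : Set (ι → ℝ))) (w : ι → ℝ) :
    ∃ s : ℝ, 0 < s ∧ x - s • w ∈ K ∧ x + s • w ∈ K := by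
  have h : ∀ u : ι → ℝ, ∀ᶠ s : ℝ in 𝓝[>] 0, x + s • u ∈ K := by
    intro u
    have hc : Tendsto (fun s : ℝ => x + s • u) (𝓝 0) (𝓝 x) := by
      have : Continuous fun s : ℝ => x + s • u := by fun_prop
      simpa using this.tendsto 0
    exact ((hc.eventually (mem_interior_iff_mem_nhds.1 hx)).filter_mono nhdsWithin_le_nhds)
  obtain ⟨s, ⟨h1, h2⟩, hs⟩ := (((h w).and (h (-w))).and self_mem_nhdsWithin).exists
  exact ⟨s, hs, by simpa [sub_eq_add_neg] using h2, h1⟩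

theorem add_mem_interior {x y : ι → ℝ} (hx : x ∈ interior (K : Set (ι → ℝ))) (hy : y ∈ K) :
    x + y ∈ interior (K : Set (ι → ℝ)) := by
  rw [mem_interior_iff_mem_nhds] at hx ⊢
  have hc : Tendsto (fun z : ι → ℝ => z - y) (𝓝 (x + y)) (𝓝 x) := by
    have : Continuous fun z : ι → ℝ => z - y := by fun_prop
    simpa using this.tendsto (x + y)
  filter_upwards [hc.eventually hx] with z hz
  simpa using add_mem (S := ProperCone ℝ (ι → ℝ)) hz hy

variable [Fintype ι]

/-- A pointed closed cone in finite dimension is normal. -/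
theorem exists_norm_le_mul_norm (hp : ∀ x : ι → ℝ, x ∈ K → -x ∈ K → x = 0) :
    ∃ c : ℝ, 0 < c ∧ ∀ x y : ι → ℝ, x ∈ K → y - x ∈ K → ‖x‖ ≤ c * ‖y‖ := by
  have hcomp : IsCompact ((K : Set (ι → ℝ)) ∩ Metric.sphere 0 1) :=
    (isCompact_sphere 0 1).inter_left K.isClosed
  have hclosed : IsClosed {x : ι → ℝ | -x ∈ K} := K.isClosed.preimage continuous_neg
  have hdisj : Disjoint ((K : Set (ι → ℝ)) ∩ Metric.sphere 0 1) {x : ι → ℝ | -x ∈ K} := by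
    rw [Set.disjoint_left]
    rintro x ⟨h1, h2⟩ h3
    rw [hp x h1 h3] at h2
    simp at h2
  obtain ⟨δ, hδ, h⟩ := Metric.exists_pos_forall_lt_edist hcomp hclosed hdisj
  have hδ' : (0 : ℝ) < δ := hδ
  -- `δ` separates the unit vectors of K from `-K`; it is applied to `x / ‖x‖` and `-(y - x) / ‖x‖`,
  -- whose distance is `‖y‖ / ‖x‖`.
  refine ⟨(δ : ℝ)⁻¹, by positivity, fun x y hx hy => ?_⟩
  rcases eq_or_ne x 0 with rfl | hx0
  · simp; positivity
  have hn : 0 < ‖x‖ := norm_pos_iff.2 hx0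
  have h1 := h (‖x‖⁻¹ • x) ⟨K.smul_mem hx (by positivity), by simp [norm_smul, hn.ne']⟩
    (-(‖x‖⁻¹ • (y - x))) (by simpa using K.smul_mem hy (inv_nonneg.2 hn.le))
  rw [edist_nndist, ENNReal.coe_lt_coe, ← NNReal.coe_lt_coe, coe_nndist, dist_eq_norm,
    sub_neg_eq_add, ← smul_add, add_sub_cancel, norm_smul, norm_inv, norm_norm] at h1
  rw [← div_eq_inv_mul, le_div_iff₀ hδ', mul_comm]
  rw [← div_eq_inv_mul, lt_div_iff₀ hn] at h1
  exact h1.le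

/-- A sequence in a pointed closed cone that decreases in the cone order converges. -/
theorem exists_tendsto_of_decreasing (hp : ∀ x : ι → ℝ, x ∈ K → -x ∈ K → x = 0)
    {a : ℕ → ι → ℝ} (ha : ∀ m, a m ∈ K) (hd : ∀ m, a m - a (m + 1) ∈ K) :
    ∃ u ∈ K, Tendsto a atTop (𝓝 u) ∧ ∀ m, a m - u ∈ K := by
  obtain ⟨c, hc, hn⟩ := exists_norm_le_mul_norm hp
  have hmono : ∀ k m, a m - a (m + k) ∈ K := by
    intro k m
    induction k with
    | zero => simp
    | succ k ih => simpa [add_assoc] using add_mem (S := ProperCone ℝ (ι → ℝ)) ih (hd (m + k))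
  have hbdd : ∀ m, a m ∈ Metric.closedBall (0 : ι → ℝ) (c * ‖a 0‖) := fun m => by
    simpa using hn _ _ (ha m) (by simpa using hmono m 0)
  obtain ⟨u, -, φ, hφ, hu⟩ := (isCompact_closedBall (0 : ι → ℝ) (c * ‖a 0‖)).tendsto_subseq hbdd
  have hle : ∀ m, a m - u ∈ K := by
    intro m
    refine K.isClosed.mem_of_tendsto (tendsto_const_nhds.sub hu) ?_
    filter_upwards [hφ.tendsto_atTop.eventually_ge_atTop m] with k hk
    obtain ⟨l, hl⟩ := Nat.exists_eq_add_of_le hk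
    simpa [hl] using hmono l m
  refine ⟨u, K.isClosed.mem_of_tendsto hu (Eventually.of_forall fun k => ha _), ?_, hle⟩
  rw [Metric.tendsto_atTop] at hu ⊢
  intro ε hε
  -- Normality upgrades subsequential convergence: past `φ N`, the difference `a m - u` lies between
  -- `0` and `a (φ N) - u`.
  obtain ⟨N, hN⟩ := hu (ε / c) (by positivity)
  refine ⟨φ N, fun m hm => ?_⟩
  obtain ⟨l, rfl⟩ := Nat.exists_eq_add_of_le hm
  have h1 := hN N le_rfl
  rw [dist_eq_norm, lt_div_iff₀ hc] at h1
  rw [dist_eq_norm]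
  refine (hn _ _ (hle (φ N + l)) ?_).trans_lt (by rw [mul_comm]; exact h1)
  simpa using hmono l (φ N)

variable {A : Matrix ι ι ℝ}

theorem smul_mulVec_mem (hA : ∀ x ∈ K, A *ᵥ x ∈ K) {c : ℝ} (hc : 0 ≤ c) :
    ∀ x ∈ K, (c • A) *ᵥ x ∈ K := fun x hx => by
  rw [Matrix.smul_mulVec]; exact K.smul_mem (hA x hx) hc

theorem sub_inv_smul_mulVec_mem {σ : ℝ} (hσ : 0 < σ) {x : ι → ℝ} (h : σ • x - A *ᵥ x ∈ K) :
    x - (σ⁻¹ • A) *ᵥ x ∈ K := by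
  have := K.smul_mem h (inv_nonneg.2 hσ.le)
  rwa [smul_sub, smul_smul, inv_mul_cancel₀ hσ.ne', one_smul, ← Matrix.smul_mulVec] at this

theorem smul_inv_mulVec {σ : ℝ} (hσ : σ ≠ 0) (x : ι → ℝ) : σ • ((σ⁻¹ • A) *ᵥ x) = A *ᵥ x := by
  rw [Matrix.smul_mulVec, smul_smul, mul_inv_cancel₀ hσ, one_smul]

variable [DecidableEq ι]

theorem pow_mulVec_mem {B : Matrix ι ι ℝ} (hB : ∀ x ∈ K, B *ᵥ x ∈ K) {x : ι → ℝ} (hx : x ∈ K)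
    (m : ℕ) : (B ^ m) *ᵥ x ∈ K := by
  induction m with
  | zero => simpa
  | succ m ih => rw [pow_succ', ← Matrix.mulVec_mulVec]; exact hB _ ih

theorem pow_sub_pow_succ_mulVec_mem {B : Matrix ι ι ℝ} (hB : ∀ x ∈ K, B *ᵥ x ∈ K) {x : ι → ℝ}
    (hx : x - B *ᵥ x ∈ K) (m : ℕ) : (B ^ m) *ᵥ x - (B ^ (m + 1)) *ᵥ x ∈ K := by
  have := pow_mulVec_mem hB hx m
  rwa [Matrix.mulVec_sub, Matrix.mulVec_mulVec, ← pow_succ] at this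

/-- Since `x` is an order unit whose orbit stays below `x`, normality bounds the orbit of every
vector. -/
theorem rho_le_of_sub_mem (hp : ∀ x : ι → ℝ, x ∈ K → -x ∈ K → x = 0)
    (hA : ∀ x ∈ K, A *ᵥ x ∈ K) {σ : ℝ} (hσ : 0 ≤ σ) {x : ι → ℝ}
    (hx : x ∈ interior (K : Set (ι → ℝ))) (h : σ • x - A *ᵥ x ∈ K) : rho A ≤ σ := by
  -- Passing to `τ > σ` permits division even when `σ = 0`.
  refine le_of_forall_gt_imp_ge_of_dense fun τ hτ => ?_
  have hτ0 : 0 < τ := hσ.trans_lt hτ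
  have hxK : x ∈ K := interior_subset hx
  have h' : τ • x - A *ᵥ x ∈ K := by
    have := add_mem h (K.smul_mem hxK (sub_nonneg.2 hτ.le))
    rwa [sub_smul, show σ • x - A *ᵥ x + (τ • x - σ • x) = τ • x - A *ᵥ x by abel] at this
  have hB := smul_mulVec_mem hA (inv_nonneg.2 hτ0.le)
  have hd := sub_inv_smul_mulVec_mem hτ0 h'
  set B := τ⁻¹ • A
  have hx0 : ∀ m : ℕ, x - (B ^ m) *ᵥ x ∈ K := by
    intro m
    induction m with
    | zero => simp
    | succ m ih =>
      have := add_mem ih (pow_sub_pow_succ_mulVec_mem hB hd m)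
      rwa [sub_add_sub_cancel] at this
  obtain ⟨c, hc, hn⟩ := exists_norm_le_mul_norm hp
  refine rho_le_of_bounded hτ0 fun w => ?_
  obtain ⟨s, hs, h1, h2⟩ := exists_pos_smul_sub_mem hx w
  refine ⟨s⁻¹ * (c * ‖(2 : ℝ) • x‖ + ‖x‖ * (c + 1)), fun m => ?_⟩
  have e1 := pow_mulVec_mem hB h2 m
  have e2 := pow_mulVec_mem hB h1 m
  -- Uses `2x - B ^ m (x + s w) = 2 (x - B ^ m x) + B ^ m (x - s w)`.
  have h3 := hn ((B ^ m) *ᵥ (x + s • w)) ((2 : ℝ) • x) e1 (by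
    have := add_mem (add_mem (hx0 m) (hx0 m)) e2
    convert this using 1
    rw [Matrix.mulVec_add, Matrix.mulVec_sub, two_smul]; abel)
  have h4 := hn _ _ (pow_mulVec_mem hB hxK m) (hx0 m)
  rw [Matrix.mulVec_add, Matrix.mulVec_smul] at h3
  have h5 : s * ‖(B ^ m) *ᵥ w‖ ≤ c * ‖(2 : ℝ) • x‖ + c * ‖x‖ := by
    calc s * ‖(B ^ m) *ᵥ w‖ = ‖((B ^ m) *ᵥ x + s • (B ^ m) *ᵥ w) - (B ^ m) *ᵥ x‖ := by
          rw [add_sub_cancel_left, norm_smul, Real.norm_of_nonneg hs.le]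
      _ ≤ _ := (norm_sub_le _ _).trans (add_le_add h3 h4)
  rw [le_inv_mul_iff₀ hs]
  nlinarith [norm_nonneg x]

theorem tsum_pow_mulVec_sub_mem {B : Matrix ι ι ℝ} (hB : ∀ x ∈ K, B *ᵥ x ∈ K) {w : ι → ℝ}
    (hw : w ∈ K) (hs : w ∈ stableSubspace B) :
    (∑' m : ℕ, (B ^ m) *ᵥ w) - w ∈ K := by
  have h : (∑' m : ℕ, (B ^ m) *ᵥ w) ∈ K :=
    K.isClosed.mem_of_tendsto (summable_pow_mulVec hs).hasSum
      (Eventually.of_forall fun s => sum_mem fun m _ => pow_mulVec_mem hB hw m)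
  have e := tsum_sub_mulVec_tsum hs
  have e' := hB _ h
  rwa [← sub_sub_cancel (∑' m : ℕ, (B ^ m) *ᵥ w) (B *ᵥ _), e] at e'

/-- The Neumann series `x` of an interior `y` dominates `y`, hence is interior, and `σ • x - A *ᵥ x
= σ • y`. -/
theorem exists_sub_mem_of_rho_lt (hf : (interior (K : Set (ι → ℝ))).Nonempty)
    (hA : ∀ x ∈ K, A *ᵥ x ∈ K) {σ : ℝ} (hσ : rho A < σ) :
    ∃ x ∈ interior (K : Set (ι → ℝ)), σ • x - A *ᵥ x ∈ K := by
  obtain ⟨y, hy⟩ := hf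
  have hσ0 : 0 < σ := (rho_nonneg A).trans_lt hσ
  have hB := smul_mulVec_mem hA (inv_nonneg.2 hσ0.le)
  have hs : y ∈ stableSubspace (σ⁻¹ • A) := tendsto_pow_mulVec_of_rho_lt hσ y
  have hyK : y ∈ K := interior_subset hy
  refine ⟨∑' m : ℕ, ((σ⁻¹ • A) ^ m) *ᵥ y, ?_, ?_⟩
  · simpa using add_mem_interior hy (tsum_pow_mulVec_sub_mem hB hyK hs)
  · rw [← smul_inv_mulVec hσ0.ne', ← smul_sub, tsum_sub_mulVec_tsum hs]
    exact K.smul_mem hyK hσ0.le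

end Cone

/-! ### The infimum of `sigmaOne` and the face criterion. -/

section Face

variable {n : ℕ} {K : ProperCone ℝ (Fin n → ℝ)} {A : Matrix (Fin n) (Fin n) ℝ}

theorem isGLB_sigmaOne (hK : IsPointedFull K) (hA : Preserves K A) :
    IsGLB (sigmaOne K A) (rho A) := by
  refine ⟨fun σ ⟨h0, x, hx, h⟩ => rho_le_of_sub_mem hK.pointed hA h0 hx h, fun b hb => ?_⟩
  refine le_of_forall_gt_imp_ge_of_dense fun σ hσ => hb ?_
  exact ⟨(rho_nonneg A).trans hσ.le, exists_sub_mem_of_rho_lt hK.full hA hσ⟩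

theorem mem_perronNullspace_iff {x : Fin n → ℝ} :
    x ∈ perronNullspace A ↔ A *ᵥ x = rho A • x := by
  simp only [perronNullspace, Set.mem_ofPred_eq, Matrix.sub_mulVec, Matrix.smul_mulVec,
    Matrix.one_mulVec, sub_eq_zero]
  exact eq_comm

/-- The elements of `K` below some element of `D` in the cone order. -/
def dominatedFace (K : ProperCone ℝ (Fin n → ℝ)) (D : PointedCone ℝ (Fin n → ℝ)) :
    PointedCone ℝ (Fin n → ℝ) where
  carrier := {x | x ∈ K ∧ ∃ d ∈ D, d - x ∈ K}
  add_mem' := by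
    rintro a b ⟨ha, d, hd, h⟩ ⟨hb, e, he, h'⟩
    refine ⟨add_mem ha hb, d + e, add_mem hd he, ?_⟩
    rw [add_sub_add_comm]
    exact add_mem h h'
  zero_mem' := ⟨zero_mem K, 0, zero_mem D, by simp⟩
  smul_mem' := by
    rintro ⟨c, hc⟩ x ⟨hx, d, hd, h⟩
    refine ⟨K.smul_mem hx hc, c • d, PointedCone.smul_mem D hc hd, ?_⟩
    have := K.smul_mem h hc
    rwa [smul_sub] at this

theorem dominatedFace_isFaceOf (D : PointedCone ℝ (Fin n → ℝ)) :
    (dominatedFace K D).IsFaceOf K.toPointedCone where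
  le := fun _ hx => hx.1
  mem_of_smul_add_mem := by
    rintro x y a hx hy ha ⟨-, d, hd, h⟩
    refine ⟨hx, a⁻¹ • d, PointedCone.smul_mem D (inv_pos.2 ha).le hd, ?_⟩
    have h1 := K.smul_mem (add_mem h hy) (inv_pos.2 ha).le
    rwa [show d - (a • x + y) + y = d - a • x by abel, smul_sub, smul_smul,
      inv_mul_cancel₀ ha.ne', one_smul] at h1

/-- The cone `(N(ρ(A) I - A) ∩ K) + C`, where `C` consists of the `w ∈ K` with `ρ_w(A) < ρ(A)`. -/
def perronPlusLower (K : ProperCone ℝ (Fin n → ℝ)) (A : Matrix (Fin n) (Fin n) ℝ) :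
    PointedCone ℝ (Fin n → ℝ) where
  carrier := {x | ∃ u ∈ K, ∃ w ∈ K, A *ᵥ u = rho A • u ∧
    w ∈ stableSubspace ((rho A)⁻¹ • A) ∧ u + w = x}
  add_mem' := by
    rintro _ _ ⟨u, hu, w, hw, h1, h2, rfl⟩ ⟨u', hu', w', hw', h1', h2', rfl⟩
    exact ⟨u + u', add_mem hu hu', w + w', add_mem hw hw',
      by rw [Matrix.mulVec_add, h1, h1', smul_add], add_mem h2 h2', by abel⟩
  zero_mem' := ⟨0, zero_mem K, 0, zero_mem K, by simp, zero_mem _, by simp⟩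
  smul_mem' := by
    rintro ⟨c, hc⟩ _ ⟨u, hu, w, hw, h1, h2, rfl⟩
    exact ⟨c • u, K.smul_mem hu hc, c • w, K.smul_mem hw hc,
      by rw [Matrix.mulVec_smul, h1, smul_comm], Submodule.smul_mem _ c h2,
      (smul_add c u w).symm⟩

/-- Here `D` plays the cone spanned by `S`. The vectors of K dominated by `D` form a face containing
`S`, so if `S` generates K, an interior point is dominated by some `d ∈ D`, itself then interior.
Conversely, a positive multiple of any vector of K lies below an interior `d`, so any face
containing `d` is all of K. -/
theorem generatedFace_eq_iff (hK : IsPointedFull K) {D : PointedCone ℝ (Fin n → ℝ)}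
    {S : Set (Fin n → ℝ)} (hSK : S ⊆ K) (hSD : S ⊆ D)
    (hDS : ∀ F : PointedCone ℝ (Fin n → ℝ), S ⊆ (F : Set (Fin n → ℝ)) → D ≤ F) :
    generatedFace K S = (K : Set (Fin n → ℝ)) ↔
      ∃ d ∈ D, d ∈ interior (K : Set (Fin n → ℝ)) := by
  constructor
  · intro h
    obtain ⟨y, hy⟩ := hK.full
    have hyG : y ∈ generatedFace K S := h ▸ interior_subset hy
    obtain ⟨-, d, hd, hdy⟩ := hyG (dominatedFace K D) (dominatedFace_isFaceOf D)
      fun s hs => ⟨hSK hs, s, hSD hs, by simp⟩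
    exact ⟨d, hd, by simpa using add_mem_interior hy hdy⟩
  · rintro ⟨d, hd, hdi⟩
    refine Set.Subset.antisymm (fun x hx => hx _ (PointedCone.IsFaceOf.refl _) hSK) ?_
    intro k hk F hF hSF
    obtain ⟨s, hs, h, -⟩ := exists_pos_smul_sub_mem hdi k
    exact hF.mem_of_smul_add_mem hk h hs (by simpa using hDS F hSF hd)

theorem rho_mem_sigmaOne_iff_generatedFace (hK : IsPointedFull K) (hA : Preserves K A)
    (hρ : 0 < rho A) :
    rho A ∈ sigmaOne K A ↔
      generatedFace K ((perronNullspace A ∩ (K : Set (Fin n → ℝ))) ∪ lowerPart K A)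
        = (K : Set (Fin n → ℝ)) := by
  have hB := smul_mulVec_mem hA (inv_nonneg.2 hρ.le)
  rw [generatedFace_eq_iff (D := perronPlusLower K A) hK]
  · constructor
    · rintro ⟨-, x, hx, h⟩
      have hxK : x ∈ K := interior_subset hx
      obtain ⟨u, hu, hlim, hle⟩ := exists_tendsto_of_decreasing hK.pointed
        (pow_mulVec_mem hB hxK)
        (pow_sub_pow_succ_mulVec_mem hB (sub_inv_smul_mulVec_mem hρ h))
      have hfix : ((rho A)⁻¹ • A) *ᵥ u = u := by
        have hc : Continuous fun z => ((rho A)⁻¹ • A) *ᵥ z :=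
          (Matrix.mulVecLin ((rho A)⁻¹ • A)).continuous_of_finiteDimensional
        refine tendsto_nhds_unique ((hc.tendsto u).comp hlim) ?_
        simpa [Function.comp_def, Matrix.mulVec_mulVec, ← pow_succ'] using
          (tendsto_add_atTop_iff_nat 1).2 hlim
      have hpow : ∀ m : ℕ, (((rho A)⁻¹ • A) ^ m) *ᵥ u = u := by
        intro m
        induction m with
        | zero => simp
        | succ m ih => rw [pow_succ, ← Matrix.mulVec_mulVec, hfix, ih]
      refine ⟨x, ⟨u, hu, x - u, by simpa using hle 0, ?_, ?_, by abel⟩, hx⟩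
      · rw [← smul_inv_mulVec hρ.ne', hfix]
      · rw [mem_stableSubspace]
        simpa [Matrix.mulVec_sub, hpow] using hlim.sub_const u
    · rintro ⟨_, ⟨u, hu, w, hw, h1, h2, rfl⟩, hx⟩
      -- The fixed part `u` contributes `0` to `rho A • x - A *ᵥ x` and the Neumann series of `w`
      -- contributes `rho A • w`.
      refine ⟨hρ.le, u + ∑' m : ℕ, (((rho A)⁻¹ • A) ^ m) *ᵥ w, ?_, ?_⟩
      · have := add_mem_interior hx (tsum_pow_mulVec_sub_mem hB hw h2)
        rwa [add_assoc, add_sub_cancel] at this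
      · rw [smul_add, Matrix.mulVec_add, h1, add_sub_add_left_eq_sub,
          ← smul_inv_mulVec hρ.ne', ← smul_sub, tsum_sub_mulVec_tsum h2]
        exact K.smul_mem hw hρ.le
  · rintro x (hx | hx)
    · exact hx.2
    · exact hx.1
  · rintro x (hx | hx)
    · exact ⟨x, hx.2, 0, zero_mem K, mem_perronNullspace_iff.1 hx.1, zero_mem _, by simp⟩
    · exact ⟨0, zero_mem K, x, hx.1, by simp, (localRho_lt_rho_iff hρ x).1 hx.2, by simp⟩
  · rintro F hF _ ⟨u, hu, w, hw, h1, h2, rfl⟩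
    exact add_mem (hF (Or.inl ⟨mem_perronNullspace_iff.2 h1, hu⟩))
      (hF (Or.inr ⟨hw, (localRho_lt_rho_iff hρ w).2 h2⟩))

end Face

/-! ### Perron theory for irreducible nonnegative matrices. -/

section Orthant

theorem positive_pointed {ι : Type*} (x : ι → ℝ) (h : x ∈ ProperCone.positive ℝ (ι → ℝ))
    (h' : -x ∈ ProperCone.positive ℝ (ι → ℝ)) : x = 0 :=
  le_antisymm (neg_nonneg.1 h') h

variable {ι : Type*} [Fintype ι]

theorem mem_interior_positive {x : ι → ℝ} :
    x ∈ interior (ProperCone.positive ℝ (ι → ℝ) : Set (ι → ℝ)) ↔ ∀ i, 0 < x i := by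
  have h : (ProperCone.positive ℝ (ι → ℝ) : Set (ι → ℝ)) = Set.univ.pi fun _ => Set.Ici 0 := by
    ext x
    simp [Pi.le_def]
  rw [h, interior_pi_set Set.finite_univ]
  simp

theorem mulVec_mem_positive {Q : Matrix ι ι ℝ} (hQ : ∀ i j, 0 ≤ Q i j) :
    ∀ x ∈ ProperCone.positive ℝ (ι → ℝ), Q *ᵥ x ∈ ProperCone.positive ℝ (ι → ℝ) :=
  fun _ hx i => Finset.sum_nonneg fun j _ => mul_nonneg (hQ i j) (hx j)

theorem smul_sub_mulVec_mem_positive_iff {Q : Matrix ι ι ℝ} {σ : ℝ} {x : ι → ℝ} :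
    σ • x - Q *ᵥ x ∈ ProperCone.positive ℝ (ι → ℝ) ↔ ∀ i, (Q *ᵥ x) i ≤ σ * x i := by
  simp [Pi.le_def]

variable [DecidableEq ι] {Q : Matrix ι ι ℝ}

theorem rho_le_of_mulVec_le (hQ : ∀ i j, 0 ≤ Q i j) {σ : ℝ} (hσ : 0 ≤ σ) {x : ι → ℝ}
    (hx : ∀ i, 0 < x i) (h : ∀ i, (Q *ᵥ x) i ≤ σ * x i) : rho Q ≤ σ :=
  rho_le_of_sub_mem positive_pointed (mulVec_mem_positive hQ) hσ (mem_interior_positive.2 hx)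
    (smul_sub_mulVec_mem_positive_iff.2 h)

theorem exists_mulVec_le_of_rho_lt (hQ : ∀ i j, 0 ≤ Q i j) {σ : ℝ} (hσ : rho Q < σ) :
    ∃ x : ι → ℝ, (∀ i, 0 < x i) ∧ ∀ i, (Q *ᵥ x) i ≤ σ * x i := by
  obtain ⟨x, hx, h⟩ := exists_sub_mem_of_rho_lt (K := ProperCone.positive ℝ (ι → ℝ))
    ⟨1, mem_interior_positive.2 fun _ => one_pos⟩ (mulVec_mem_positive hQ) hσ
  exact ⟨x, mem_interior_positive.1 hx, smul_sub_mulVec_mem_positive_iff.1 h⟩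

/-- Subinvariant vectors at levels decreasing to `rho Q`, normalized to the simplex, have a limit
point; irreducibility keeps its entries positive, since a zero entry would spread along arcs to all
indices. -/
theorem exists_mulVec_le_rho_of_irreducible (hQ : ∀ i j, 0 ≤ Q i j)
    (hirr : ∀ i j, Relation.ReflTransGen (fun i j => Q i j ≠ 0) i j) :
    ∃ x : ι → ℝ, (∀ i, 0 < x i) ∧ ∀ i, (Q *ᵥ x) i ≤ rho Q * x i := by
  rcases isEmpty_or_nonempty ι with _ | _
  · exact ⟨1, isEmptyElim, isEmptyElim⟩
  have hex : ∀ m : ℕ, ∃ x ∈ stdSimplex ℝ ι,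
      ∀ i, (Q *ᵥ x) i ≤ (rho Q + 1 / ((m : ℝ) + 1)) * x i := by
    intro m
    obtain ⟨x, hx, h⟩ := exists_mulVec_le_of_rho_lt hQ
      (show rho Q < rho Q + 1 / ((m : ℝ) + 1) by linarith [Nat.one_div_pos_of_nat (α := ℝ) (n := m)])
    have hs : 0 < ∑ i, x i := Finset.sum_pos (fun i _ => hx i) Finset.univ_nonempty
    refine ⟨(∑ i, x i)⁻¹ • x, ⟨fun i => ?_, ?_⟩, fun i => ?_⟩
    · exact mul_nonneg (inv_nonneg.2 hs.le) (hx i).le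
    · simp [← Finset.mul_sum, hs.ne']
    · rw [Matrix.mulVec_smul, Pi.smul_apply, Pi.smul_apply, smul_eq_mul, smul_eq_mul,
        mul_left_comm]
      exact mul_le_mul_of_nonneg_left (h i) (inv_nonneg.2 hs.le)
  choose x hxS hx using hex
  obtain ⟨v, hvS, φ, hφ, hv⟩ := (isCompact_stdSimplex ℝ ι).tendsto_subseq hxS
  have hle : ∀ i, (Q *ᵥ v) i ≤ rho Q * v i := by
    intro i
    have h1 : Tendsto (fun k => (Q *ᵥ x (φ k)) i) atTop (𝓝 ((Q *ᵥ v) i)) := by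
      have hc : Continuous fun z => (Q *ᵥ z) i :=
        (continuous_apply i).comp (Matrix.mulVecLin Q).continuous_of_finiteDimensional
      exact (hc.tendsto v).comp hv
    have h2 : Tendsto (fun k => (rho Q + 1 / ((φ k : ℝ) + 1)) * x (φ k) i) atTop
        (𝓝 ((rho Q + 0) * v i)) :=
      (tendsto_const_nhds.add (tendsto_one_div_add_atTop_nhds_zero_nat.comp hφ.tendsto_atTop)).mul
        (((continuous_apply i).tendsto v).comp hv)
    rw [add_zero] at h2
    exact le_of_tendsto_of_tendsto' h1 h2 fun k => hx (φ k) i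
  have hzero : ∀ i j, Relation.ReflTransGen (fun i j => Q i j ≠ 0) i j → v i = 0 → v j = 0 := by
    intro i j hij hi
    induction hij with
    | refl => exact hi
    | @tail b c _ hbc ih =>
      have h1 := hle b
      rw [ih, mul_zero] at h1
      have h2 : Q b c * v c ≤ (Q *ᵥ v) b := Finset.single_le_sum (f := fun j => Q b j * v j)
        (fun j _ => mul_nonneg (hQ b j) (hvS.1 j)) (Finset.mem_univ c)
      have h3 := mul_nonneg (hQ b c) (hvS.1 c)
      exact (mul_eq_zero.1 (le_antisymm (h2.trans h1) h3)).resolve_left hbc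
  refine ⟨v, fun i => lt_of_le_of_ne (hvS.1 i) fun hi => ?_, hle⟩
  have h0 : ∑ j, v j = 0 := Finset.sum_eq_zero fun j _ => hzero i j (hirr i j) hi.symm
  exact zero_ne_one (h0.symm.trans hvS.2)

/-- Each factor `1 + Q` keeps positive entries positive and spreads positivity one arc backwards. -/
theorem one_add_pow_mulVec_pos (hQ : ∀ i j, 0 ≤ Q i j)
    (hirr : ∀ i j, Relation.ReflTransGen (fun i j => Q i j ≠ 0) i j) {w : ι → ℝ}
    (hw : ∀ i, 0 ≤ w i) {j : ι} (hj : 0 < w j) :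
    ∃ k : ℕ, ∀ i, 0 < (((1 + Q) ^ k) *ᵥ w) i := by
  have hsucc : ∀ k i, (((1 + Q) ^ (k + 1)) *ᵥ w) i =
      (((1 + Q) ^ k) *ᵥ w) i + (Q *ᵥ (((1 + Q) ^ k) *ᵥ w)) i := by
    intro k i
    rw [pow_succ', ← Matrix.mulVec_mulVec, Matrix.add_mulVec, Matrix.one_mulVec, Pi.add_apply]
  have hnn : ∀ k i, 0 ≤ (((1 + Q) ^ k) *ᵥ w) i := by
    intro k
    induction k with
    | zero => simpa using hw
    | succ k ih =>
      intro i
      rw [hsucc]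
      exact add_nonneg (ih i) (mulVec_mem_positive hQ _ ih i)
  have hmono : ∀ i, Monotone fun k => (((1 + Q) ^ k) *ᵥ w) i := fun i =>
    monotone_nat_of_le_succ fun k => by
      rw [hsucc]
      exact le_add_of_nonneg_right (mulVec_mem_positive hQ _ (hnn k) i)
  have hex : ∀ i, ∃ k : ℕ, 0 < (((1 + Q) ^ k) *ᵥ w) i := by
    intro i
    induction hirr i j using Relation.ReflTransGen.head_induction_on with
    | refl => exact ⟨0, by simpa using hj⟩
    | @head a c hac _ ih =>
      obtain ⟨k, hk⟩ := ih
      refine ⟨k + 1, ?_⟩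
      rw [hsucc]
      have h1 : Q a c * (((1 + Q) ^ k) *ᵥ w) c ≤ (Q *ᵥ (((1 + Q) ^ k) *ᵥ w)) a :=
        Finset.single_le_sum (f := fun j => Q a j * (((1 + Q) ^ k) *ᵥ w) j)
          (fun j _ => mul_nonneg (hQ a j) (hnn k j)) (Finset.mem_univ c)
      exact add_pos_of_nonneg_of_pos (hnn k a)
        ((mul_pos (lt_of_le_of_ne (hQ a c) hac.symm) hk).trans_le h1)
  choose k hk using hex
  exact ⟨∑ i, k i, fun i => (hk i).trans_le
    (hmono i (Finset.single_le_sum (fun _ _ => Nat.zero_le _) (Finset.mem_univ i)))⟩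

/-- For an irreducible nonnegative matrix, a positive vector with `Q x ≤ ρ(Q) x` is a Perron
vector. -/
theorem mulVec_eq_rho_of_irreducible (hQ : ∀ i j, 0 ≤ Q i j)
    (hirr : ∀ i j, Relation.ReflTransGen (fun i j => Q i j ≠ 0) i j) {x : ι → ℝ}
    (hx : ∀ i, 0 < x i) (h : ∀ i, (Q *ᵥ x) i ≤ rho Q * x i) (j : ι) :
    (Q *ᵥ x) j = rho Q * x j := by
  by_contra hne
  set w := rho Q • x - Q *ᵥ x with hwdef
  have hw : ∀ i, 0 ≤ w i := fun i => by simpa [hwdef] using h i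
  have hj : 0 < w j := by simpa [hwdef] using lt_of_le_of_ne (h j) hne
  obtain ⟨k, hk⟩ := one_add_pow_mulVec_pos hQ hirr hw hj
  have hQ1 : ∀ i j, 0 ≤ (1 + Q) i j := fun i j => by
    have : 0 ≤ (1 : Matrix ι ι ℝ) i j := by rw [Matrix.one_apply]; split_ifs <;> norm_num
    exact add_nonneg this (hQ i j)
  -- As `(1 + Q) ^ k` commutes with `Q`, a nonzero defect `w` becomes a strictly positive defect of
  -- `z`; the largest ratio `(Q z) i / z i` then bounds `rho Q` by something smaller than itself.
  set z := ((1 + Q) ^ k) *ᵥ x with hz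
  have hznn : ∀ i, 0 ≤ z i :=
    pow_mulVec_mem (mulVec_mem_positive hQ1) (x := x) (fun i => (hx i).le) k
  have hcomm : ((1 + Q) ^ k) *ᵥ w = rho Q • z - Q *ᵥ z := by
    have hc : Commute ((1 + Q) ^ k) Q :=
      ((Commute.one_left Q).add_left (Commute.refl Q)).pow_left k
    rw [hwdef, Matrix.mulVec_sub, Matrix.mulVec_smul, Matrix.mulVec_mulVec, hc.eq,
      ← Matrix.mulVec_mulVec]
  have hlt : ∀ i, (Q *ᵥ z) i < rho Q * z i := fun i => by
    simpa [hcomm] using hk i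
  have hQz : ∀ i, 0 ≤ (Q *ᵥ z) i := mulVec_mem_positive hQ z hznn
  have hzpos : ∀ i, 0 < z i := fun i => lt_of_le_of_ne (hznn i) fun h0 => by
    have := hlt i
    rw [← h0, mul_zero] at this
    exact (hQz i).not_gt this
  have : Nonempty ι := ⟨j⟩
  obtain ⟨i₀, -, hi₀⟩ := Finset.exists_max_image Finset.univ (fun i => (Q *ᵥ z) i / z i)
    Finset.univ_nonempty
  have h1 : rho Q ≤ (Q *ᵥ z) i₀ / z i₀ :=
    rho_le_of_mulVec_le hQ (div_nonneg (hQz _) (hznn _)) hzpos fun i =>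
      (div_le_iff₀ (hzpos i)).1 (hi₀ i (Finset.mem_univ i))
  exact (((div_lt_iff₀ (hzpos i₀)).2 (hlt i₀)).trans_le h1).false

end Orthant

/-! ### Access classes and the combinatorial criterion. -/

section Classes

variable {n : ℕ} {P : Matrix (Fin n) (Fin n) ℝ}

theorem HasAccess.refl (P : Matrix (Fin n) (Fin n) ℝ) (i : Fin n) : HasAccess P i i :=
  Relation.ReflTransGen.refl

theorem IsClass.hasAccess {α : Finset (Fin n)} (hα : IsClass P α) {i j : Fin n} (hi : i ∈ α)
    (hj : j ∈ α) : HasAccess P i j := by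
  obtain ⟨k, hk⟩ := hα
  exact ((hk i).1 hi).2.trans ((hk j).1 hj).1

theorem IsClass.mem_of_hasAccess {α : Finset (Fin n)} (hα : IsClass P α) {i j : Fin n}
    (hi : i ∈ α) (hij : HasAccess P i j) (hji : HasAccess P j i) : j ∈ α := by
  obtain ⟨k, hk⟩ := hα
  exact (hk j).2 ⟨((hk i).1 hi).1.trans hij, hji.trans ((hk i).1 hi).2⟩

theorem IsClass.eq_of_mem {α β : Finset (Fin n)} (hα : IsClass P α) (hβ : IsClass P β)
    {i : Fin n} (hiα : i ∈ α) (hiβ : i ∈ β) : α = β := by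
  ext j
  exact ⟨fun hj => hβ.mem_of_hasAccess hiβ (hα.hasAccess hiα hj) (hα.hasAccess hj hiα),
    fun hj => hα.mem_of_hasAccess hiα (hβ.hasAccess hiβ hj) (hβ.hasAccess hj hiβ)⟩

open scoped Classical in
/-- The class of the index `i`. -/
def classOf (P : Matrix (Fin n) (Fin n) ℝ) (i : Fin n) : Finset (Fin n) :=
  Finset.univ.filter fun j => HasAccess P i j ∧ HasAccess P j i

theorem isClass_classOf (i : Fin n) : IsClass P (classOf P i) := ⟨i, fun j => by simp [classOf]⟩

theorem mem_classOf_self (i : Fin n) : i ∈ classOf P i := by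
  simpa [classOf] using HasAccess.refl P i

theorem classOf_eq {i j : Fin n} (hj : j ∈ classOf P i) : classOf P j = classOf P i :=
  (isClass_classOf j).eq_of_mem (isClass_classOf i) (mem_classOf_self j) hj

/-- The principal submatrix `P_αα`. -/
abbrev block (P : Matrix (Fin n) (Fin n) ℝ) (α : Finset (Fin n)) : Matrix α α ℝ :=
  P.submatrix (fun i : α => (i : Fin n)) (fun i : α => (i : Fin n))

theorem block_mulVec (α : Finset (Fin n)) (x : Fin n → ℝ) (i : α) :
    (block P α *ᵥ fun j : α => x j) i = ∑ j ∈ α, P i j * x j :=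
  Finset.sum_coe_sort α fun j => P i j * x j

theorem mulVec_eq_sum_add_sum_compl (α : Finset (Fin n)) (x : Fin n → ℝ) (i : Fin n) :
    (P *ᵥ x) i = ∑ j ∈ α, P i j * x j + ∑ j ∈ αᶜ, P i j * x j :=
  (Finset.sum_add_sum_compl α fun j => P i j * x j).symm

/-- A path between two members of a class never leaves it, as each vertex on it has access back to
the start. -/
theorem IsClass.block_irreducible {α : Finset (Fin n)} (hα : IsClass P α) (i j : α) :
    Relation.ReflTransGen (fun i j => block P α i j ≠ 0) i j := by
  obtain ⟨i, hi⟩ := i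
  have h : HasAccess P i j := hα.hasAccess hi j.2
  induction h using Relation.ReflTransGen.head_induction_on with
  | refl => exact .refl
  | @head a c hac hcj ih =>
    have hc : c ∈ α := hα.mem_of_hasAccess hi (.single hac) (hcj.trans (hα.hasAccess j.2 hi))
    have h1 : block P α ⟨a, hi⟩ ⟨c, hc⟩ ≠ 0 := hac
    exact .head h1 (ih hc)

theorem rho_block_le (hP : ∀ i j, 0 ≤ P i j) (α : Finset (Fin n)) : rho (block P α) ≤ rho P := by
  refine le_of_forall_gt_imp_ge_of_dense fun σ hσ => ?_
  obtain ⟨x, hx, h⟩ := exists_mulVec_le_of_rho_lt hP hσ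
  refine rho_le_of_mulVec_le (Q := block P α) (x := fun j : α => x j) (fun i j => hP i j)
    ((rho_nonneg P).trans hσ.le) (fun i => hx i) fun i => ?_
  rw [block_mulVec]
  refine le_trans ?_ (h i)
  rw [mulVec_eq_sum_add_sum_compl α]
  exact le_add_of_nonneg_right (Finset.sum_nonneg fun j _ => mul_nonneg (hP _ _) (hx j).le)

theorem exists_arc_leaving {α : Finset (Fin n)} {i j : Fin n} (hij : HasAccess P i j)
    (hi : i ∈ α) (hj : j ∉ α) : ∃ k ∈ α, ∃ l ∉ α, P k l ≠ 0 := by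
  induction hij with
  | refl => exact absurd hi hj
  | @tail b c _ hbc ih =>
    by_cases hb : b ∈ α
    · exact ⟨b, hb, c, hj, hbc⟩
    · exact ih hb

/-- On a basic class the restriction of `x` is subinvariant at the block's own spectral radius, so
equality holds there; an arc leaving the class would add a positive term and break the inequality.
-/
theorem isFinal_of_mulVec_le (hP : ∀ i j, 0 ≤ P i j) {x : Fin n → ℝ} (hx : ∀ i, 0 < x i)
    (h : ∀ i, (P *ᵥ x) i ≤ rho P * x i) {α : Finset (Fin n)} (hα : IsClass P α)
    (hb : IsBasic P α) : IsFinal P α := by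
  rintro β hβ ⟨i, hi, j, hj, hij⟩
  by_contra hne
  obtain ⟨k, hk, l, hl, hkl⟩ := exists_arc_leaving hij hi
    fun hjα => hne (hβ.eq_of_mem hα hj hjα)
  have hb' : rho (block P α) = rho P := hb
  have hrest : ∀ i, 0 ≤ ∑ j ∈ αᶜ, P i j * x j := fun i =>
    Finset.sum_nonneg fun j _ => mul_nonneg (hP _ _) (hx j).le
  have heq := mulVec_eq_rho_of_irreducible (Q := block P α) (x := fun j : α => x j)
    (fun i j => hP i j) hα.block_irreducible (fun i => hx i) (fun i => by
      have := h i
      rw [mulVec_eq_sum_add_sum_compl α] at this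
      rw [block_mulVec, hb']
      linarith [hrest i]) ⟨k, hk⟩
  rw [block_mulVec, hb'] at heq
  have hpos : 0 < ∑ j ∈ αᶜ, P k j * x j :=
    Finset.sum_pos' (fun j _ => mul_nonneg (hP _ _) (hx j).le)
      ⟨l, Finset.mem_compl.2 hl, mul_pos (lt_of_le_of_ne (hP k l) hkl.symm) (hx l)⟩
  have := h k
  rw [mulVec_eq_sum_add_sum_compl α] at this
  simp only at heq
  linarith

/-- A basic class gets a vector at level `rho P`; any other class has room for a level strictly
below, and that slack later pays for its outgoing arcs. -/
theorem exists_class_weights (hP : ∀ i j, 0 ≤ P i j)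
    (hfin : ∀ α, IsClass P α → IsBasic P α → IsFinal P α) {α : Finset (Fin n)}
    (hα : IsClass P α) :
    ∃ v : Fin n → ℝ, (∀ i, 0 < v i) ∧ ∀ i ∈ α, ∑ j ∈ α, P i j * v j ≤ rho P * v i ∧
      (IsFinal P α ∨ ∑ j ∈ α, P i j * v j < rho P * v i) := by
  have extend : ∀ {σ : ℝ} {x : α → ℝ}, (∀ i, 0 < x i) →
      (∀ i, (block P α *ᵥ x) i ≤ σ * x i) →
      ∃ v : Fin n → ℝ, (∀ i, 0 < v i) ∧ ∀ i ∈ α, ∑ j ∈ α, P i j * v j ≤ σ * v i := by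
    intro σ x hx h
    let v : Fin n → ℝ := fun i => if hi : i ∈ α then x ⟨i, hi⟩ else 1
    have hv : (fun j : α => v j) = x := by
      funext j
      simp [v]
    refine ⟨v, fun i => ?_, fun i hi => ?_⟩
    · by_cases hi : i ∈ α <;> simp [v, hi, hx]
    · have h1 := h ⟨i, hi⟩
      rw [← hv, block_mulVec] at h1
      exact h1
  have hQ : ∀ i j, 0 ≤ block P α i j := fun i j => hP i j
  by_cases hb : IsBasic P α
  · obtain ⟨x, hx, h⟩ := exists_mulVec_le_rho_of_irreducible hQ hα.block_irreducible
    obtain ⟨v, hv, hle⟩ := extend hx h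
    have hb' : rho (block P α) = rho P := hb
    rw [hb'] at hle
    exact ⟨v, hv, fun i hi => ⟨hle i hi, Or.inl (hfin α hα hb)⟩⟩
  · obtain ⟨σ, h1, h2⟩ := exists_between (lt_of_le_of_ne (rho_block_le hP α) hb)
    obtain ⟨x, hx, h⟩ := exists_mulVec_le_of_rho_lt hQ h1
    obtain ⟨v, hv, hle⟩ := extend hx h
    have hlt : ∀ i ∈ α, ∑ j ∈ α, P i j * v j < rho P * v i := fun i hi =>
      (hle i hi).trans_lt (mul_lt_mul_of_pos_right h2 (hv i))
    exact ⟨v, hv, fun i hi => ⟨(hlt i hi).le, Or.inr (hlt i hi)⟩⟩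

open scoped Classical in
/-- The number of indices to which `i` has access. -/
def height (P : Matrix (Fin n) (Fin n) ℝ) (i : Fin n) : ℕ :=
  (Finset.univ.filter fun j => HasAccess P i j).card

theorem height_le {i j : Fin n} (h : HasAccess P i j) : height P j ≤ height P i := by
  refine Finset.card_le_card fun k hk => ?_
  simp only [Finset.mem_filter, Finset.mem_univ, true_and] at hk ⊢
  exact h.trans hk

theorem height_lt {i j : Fin n} (h : HasAccess P i j) (h' : ¬ HasAccess P j i) :
    height P j < height P i := by
  refine Finset.card_lt_card (Finset.ssubset_iff_of_subset ?_ |>.2 ⟨i, ?_, ?_⟩)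
  · intro k hk
    simp only [Finset.mem_filter, Finset.mem_univ, true_and] at hk ⊢
    exact h.trans hk
  · simpa using HasAccess.refl P i
  · simpa using h'

/-- Class weights are scaled by `M ^ height`. Height is constant on a class and drops along arcs
leaving it, so outside contributions carry an extra factor `1 / M`; for large `M` the slack of a
non-final class absorbs them, and a final class has none. -/
theorem exists_mulVec_le_of_basic_final (hP : ∀ i j, 0 ≤ P i j)
    (hfin : ∀ α, IsClass P α → IsBasic P α → IsFinal P α) :
    ∃ x : Fin n → ℝ, (∀ i, 0 < x i) ∧ ∀ i, (P *ᵥ x) i ≤ rho P * x i := by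
  choose V hV hV' using fun α : {α // IsClass P α} => exists_class_weights hP hfin α.2
  let c : Fin n → {α // IsClass P α} := fun i => ⟨classOf P i, isClass_classOf i⟩
  let gap : Fin n → ℝ := fun i => rho P * V (c i) i - ∑ j ∈ classOf P i, P i j * V (c i) j
  let rest : Fin n → ℝ := fun i => ∑ j ∈ (classOf P i)ᶜ, P i j * V (c j) j
  have hM : ∀ᶠ M : ℝ in atTop, ∀ i, rest i ≤ M * gap i := by
    rw [eventually_all]
    intro i
    obtain ⟨h1, h2 | h2⟩ := hV' (c i) i (mem_classOf_self i)
    · have h0 : rest i = 0 := Finset.sum_eq_zero fun j hj => by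
        by_contra hne
        have he : classOf P j = classOf P i := h2 (classOf P j) (isClass_classOf j)
          ⟨i, mem_classOf_self i, j, mem_classOf_self j, .single (left_ne_zero_of_mul hne)⟩
        exact Finset.mem_compl.1 hj (he ▸ mem_classOf_self j)
      filter_upwards [eventually_ge_atTop 0] with M hM
      rw [h0]
      exact mul_nonneg hM (sub_nonneg.2 h1)
    · filter_upwards [eventually_ge_atTop (rest i / gap i)] with M hM
      exact (div_le_iff₀ (sub_pos.2 h2)).1 hM
  obtain ⟨M, hM, hM1⟩ := (hM.and (eventually_ge_atTop 1)).exists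
  have hM0 : 0 < M := one_pos.trans_le hM1
  refine ⟨fun i => M ^ height P i * V (c i) i, fun i => mul_pos (pow_pos hM0 _) (hV _ i),
    fun i => ?_⟩
  rw [mulVec_eq_sum_add_sum_compl (classOf P i)]
  have hin : ∑ j ∈ classOf P i, P i j * (M ^ height P j * V (c j) j) =
      M ^ height P i * ∑ j ∈ classOf P i, P i j * V (c i) j := by
    rw [Finset.mul_sum]
    refine Finset.sum_congr rfl fun j hj => ?_
    have hcj : c j = c i := Subtype.ext (classOf_eq hj)
    have hacc : HasAccess P i j ∧ HasAccess P j i := by simpa [classOf] using hj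
    rw [hcj, le_antisymm (height_le hacc.1) (height_le hacc.2)]
    ring
  have hout : M * ∑ j ∈ (classOf P i)ᶜ, P i j * (M ^ height P j * V (c j) j) ≤
      M ^ height P i * rest i := by
    rw [Finset.mul_sum, Finset.mul_sum]
    refine Finset.sum_le_sum fun j hj => ?_
    by_cases hz : P i j = 0
    · simp [hz]
    have hij : HasAccess P i j := .single hz
    have hlt := height_lt hij fun hji =>
      Finset.mem_compl.1 hj (by simpa [classOf] using And.intro hij hji)
    have hpow : M ^ (height P j + 1) ≤ M ^ height P i := pow_le_pow_right₀ hM1 hlt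
    calc M * (P i j * (M ^ height P j * V (c j) j))
        = M ^ (height P j + 1) * (P i j * V (c j) j) := by ring
      _ ≤ _ := mul_le_mul_of_nonneg_right hpow (mul_nonneg (hP i j) (hV _ j).le)
  have hout' : ∑ j ∈ (classOf P i)ᶜ, P i j * (M ^ height P j * V (c j) j) ≤
      M ^ height P i * gap i := by
    refine le_of_mul_le_mul_left (hout.trans ?_) hM0
    rw [mul_left_comm]
    exact mul_le_mul_of_nonneg_left (hM i) (pow_pos hM0 _).le
  calc _ ≤ M ^ height P i * ∑ j ∈ classOf P i, P i j * V (c i) j + M ^ height P i * gap i :=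
        add_le_add hin.le hout'
    _ = _ := by simp only [gap]; ring

theorem rho_mem_sigmaOne_positive_iff (hP : ∀ i j, 0 ≤ P i j) :
    rho P ∈ sigmaOne (ProperCone.positive ℝ (Fin n → ℝ)) P ↔
      ∀ α : Finset (Fin n), IsClass P α → IsBasic P α → IsFinal P α := by
  constructor
  · rintro ⟨-, x, hx, h⟩ α hα hb
    exact isFinal_of_mulVec_le hP (mem_interior_positive.1 hx)
      (smul_sub_mulVec_mem_positive_iff.1 h) hα hb
  · intro h
    obtain ⟨x, hx, hle⟩ := exists_mulVec_le_of_basic_final hP h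
    exact ⟨rho_nonneg P, x, mem_interior_positive.2 hx, smul_sub_mulVec_mem_positive_iff.2 hle⟩

end Classes

end ConeMap

end

theorem theorem5p7 (n : ℕ) :
    (∀ (K : ProperCone ℝ (Fin n → ℝ)) (A : Matrix (Fin n) (Fin n) ℝ),
      ConeMap.IsPointedFull K → ConeMap.Preserves K A →
        IsGLB (ConeMap.sigmaOne K A) (ConeMap.rho A) ∧
        (0 < ConeMap.rho A →
          (ConeMap.rho A ∈ ConeMap.sigmaOne K A ↔
            ConeMap.generatedFace K
              ((ConeMap.perronNullspace A ∩ (K : Set (Fin n → ℝ))) ∪ ConeMap.lowerPart K A)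
                = (K : Set (Fin n → ℝ))))) ∧
    (∀ P : Matrix (Fin n) (Fin n) ℝ, (∀ i j, 0 ≤ P i j) →
      (ConeMap.rho P ∈ ConeMap.sigmaOne (ProperCone.positive ℝ (Fin n → ℝ)) P ↔
        ∀ α : Finset (Fin n), ConeMap.IsClass P α → ConeMap.IsBasic P α →
          ConeMap.IsFinal P α)) := by
  refine ⟨fun K A hK hA => ⟨ConeMap.isGLB_sigmaOne hK hA, fun hρ =>
    ConeMap.rho_mem_sigmaOne_iff_generatedFace hK hA hρ⟩, fun P hP =>
    ConeMap.rho_mem_sigmaOne_positive_iff hP⟩
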